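/- For $m\ge 0$ let $\mathfrak S_m$ be the set of permutations of $[m]=\{1,\dots,m\}$. For $\pi\in\mathfrak S_m$ let $\mathrm{asc}(\pi)$ be the number of $i\in[m-1]$ with $\pi(i)<\pi(i+1)$ and let $\mathrm{exc}(\pi)$ be the number of $i\in[m]$ with $\pi(i)>i$; a succession of $\pi$ is an index $i\in[m-1]$ with $\pi(i+1)=\pi(i)+1$. Let $\mathcal D_m\subseteq\mathfrak S_m$ be the set of permutations without fixed points. Let $B_m$ be the group of permutations $w$ of $\{\pm1,\dots,\pm m\}$ with $w(-i)=-w(i)$ for all $i$, let $\mathcal D_m^B$ be the set of $w\in B_m$ with $w(i)\neq i$ for all $i\in[m]$, and for $w\in B_m$ let $\mathrm{exc}_B(w)$ be the number of $i\in[m]$ with $w(|w(i)|)>w(i)$. Define the polynomials $$S_m(x)=\sum_{\substack{\pi\in\mathfrak S_{m+1}\\ \pi\text{ has no successions}}}x^{\mathrm{asc}(\pi)},\qquad A_m(x)=\sum_{\pi\in\mathfrak S_m}x^{\mathrm{exc}(\pi)},$$ $$d_m(x)=\sum_{\pi\in\mathcal D_m}x^{\mathrm{exc}(\pi)},\qquad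 d_m^B(x)=\sum_{w\in\mathcal D_m^B}x^{\mathrm{exc}_B(w)}.$$ Then for every integer $n\ge 0$, $$S_n(x)=\frac1{2^n}\sum_{i=0}^n\binom ni d_i^B(x)\,d_{n-i}^B(x)\qquad\text{and}\qquad S_n(x)=\sum_{i=0}^n\binom ni A_i(x)\,d_{n-i}(x).$$ -/

import Mathlib

open Polynomial

namespace SuccessionFree

/-! A permutation of `[n]` is an element of `Equiv.Perm (Fin n)`, with `i : Fin n` standing for
the letter `i + 1`. -/

/-- The number of ascents: positions `i` with a successor position and `π(i) < π(i+1)`. -/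
def asc {n : ℕ} (π : Equiv.Perm (Fin n)) : ℕ :=
  (Finset.univ.filter fun i : Fin n => ∃ h : (i : ℕ) + 1 < n, π i < π ⟨(i : ℕ) + 1, h⟩).card

/-- The number of excedances: positions `i` with `π(i) > i`. -/
def exc {n : ℕ} (π : Equiv.Perm (Fin n)) : ℕ :=
  (Finset.univ.filter fun i : Fin n => i < π i).card

/-- The position `i` is a succession of `π`: `π(i+1) = π(i) + 1`. -/
def IsSuccession {n : ℕ} (π : Equiv.Perm (Fin n)) (i : Fin n) : Prop :=
  ∃ h : (i : ℕ) + 1 < n, (π ⟨(i : ℕ) + 1, h⟩ : ℕ) = (π i : ℕ) + 1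

open Classical in
/-- `S_n(x)`: the ascent polynomial of the permutations of `[n+1]` without successions. -/
noncomputable def S (n : ℕ) : ℚ[X] :=
  ∑ π : Equiv.Perm (Fin (n + 1)) with ∀ i, ¬ IsSuccession π i, X ^ asc π

/-- The Eulerian polynomial `A_n(x)`. -/
noncomputable def eulerian (n : ℕ) : ℚ[X] :=
  ∑ π : Equiv.Perm (Fin n), X ^ exc π

open Classical in
/-- The derangement polynomial `d_n(x)`. -/
noncomputable def derangementPoly (n : ℕ) : ℚ[X] :=
  ∑ π : Equiv.Perm (Fin n) with π ∈ derangements (Fin n), X ^ exc π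

/-- The set `±[n] = {1, …, n} ∪ {-1, …, -n}`. -/
abbrev PM (n : ℕ) : Type := {z : ℤ // z ∈ (Finset.Icc (-(n : ℤ)) (n : ℤ)).erase 0}

/-- Negation on `±[n]`. -/
def PM.neg {n : ℕ} (z : PM n) : PM n :=
  ⟨-z.1, by
    have h := z.2
    simp only [Finset.mem_erase, Finset.mem_Icc] at h ⊢
    omega⟩

/-- Absolute value on `±[n]`. -/
def PM.abs {n : ℕ} (z : PM n) : PM n :=
  ⟨(z.1.natAbs : ℤ), by
    have h := z.2
    simp only [Finset.mem_erase, Finset.mem_Icc] at h ⊢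
    omega⟩

/-- `w` belongs to the hyperoctahedral group `B_n`: it is a permutation of `±[n]` with
`w(-i) = -w(i)`. -/
def IsSignedPerm {n : ℕ} (w : Equiv.Perm (PM n)) : Prop :=
  ∀ i : PM n, w i.neg = (w i).neg

/-- A type `B` derangement is a signed permutation with `w(i) ≠ i` for all `i ∈ [n]`. -/
def IsDerangementB {n : ℕ} (w : Equiv.Perm (PM n)) : Prop :=
  IsSignedPerm w ∧ ∀ i : PM n, 0 < i.1 → w i ≠ i

/-- The number of type `B` excedances: indices `i ∈ [n]` with `w(|w(i)|) > w(i)`. -/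
noncomputable def excB {n : ℕ} (w : Equiv.Perm (PM n)) : ℕ :=
  (Finset.univ.filter fun i : PM n => 0 < i.1 ∧ (w i).1 < (w (w i).abs).1).card

open Classical in
/-- The type `B` derangement polynomial `d_n^B(x)`. -/
noncomputable def derangementPolyB (n : ℕ) : ℚ[X] :=
  ∑ w : Equiv.Perm (PM n) with IsDerangementB w, X ^ excB w

end SuccessionFree

open Polynomial

namespace SuccessionFree

/-! Write `S`, `A`, `d`, `B` for the exponential generating functions in `t` of the succession-free,
Eulerian, derangement and type B derangement polynomials. Both identities follow from three product
formulas.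

Choosing the fixed points of a permutation gives `A = exp(t) * d` (`egf_eulerian`). A signed
permutation is an ordinary permutation with a set of negative values, and its excedances are
ordinary ones for the order of the signed values; hence `B(t) = exp(t) * d(2t)`
(`egf_derangementPolyB`).

The third formula, `S = A * d` (`egf_S`), is the second identity. It comes from the derivation `D =
(1 - x t) ∂ₜ - x (1 - x) ∂ₓ`: the Eulerian recurrence says `D A = A`, so `A = exp(t) * d` forces `D
d = x t d`, and `A * d` satisfies `D f = (1 + x t) f`. The recurrence `S_succ_succ`, obtained by
inserting a maximum and collapsing a succession, says that `S` satisfies the same equation, whose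
solution is fixed by its constant term.

Finally `B(t/2)^2 = exp(t) * d(t)^2 = A * d = S`, which is the first identity. -/

/-! ### Exponential generating functions. -/

/-- The exponential generating function of a sequence of polynomials. -/
noncomputable def egf (a : ℕ → ℚ[X]) : PowerSeries ℚ[X] :=
  PowerSeries.mk fun n => C ((n.factorial : ℚ)⁻¹) * a n

lemma coeff_egf (a : ℕ → ℚ[X]) (n : ℕ) :
    PowerSeries.coeff n (egf a) = C ((n.factorial : ℚ)⁻¹) * a n := by
  simp [egf]

lemma egf_injective : Function.Injective egf := by
  intro a b h
  funext n
  have h1 := congrArg (PowerSeries.coeff n) h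
  rw [coeff_egf, coeff_egf] at h1
  refine mul_left_cancel₀ ?_ h1
  simpa using Nat.factorial_ne_zero n

lemma egf_mul (a b : ℕ → ℚ[X]) :
    egf a * egf b =
      egf fun n => ∑ i ∈ Finset.range (n + 1), (n.choose i : ℚ[X]) * a i * b (n - i) := by
  ext1 n
  rw [PowerSeries.coeff_mul, coeff_egf, Finset.mul_sum,
    Finset.Nat.sum_antidiagonal_eq_sum_range_succ_mk]
  refine Finset.sum_congr rfl fun i hi => ?_
  have hin : i ≤ n := Nat.lt_succ_iff.mp (Finset.mem_range.mp hi)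
  have hc : (n.choose i : ℚ[X]) = C (n.choose i : ℚ) := by simp
  have h1 : ((i.factorial : ℚ)⁻¹) * ((n - i).factorial : ℚ)⁻¹ =
      (n.factorial : ℚ)⁻¹ * (n.choose i : ℚ) := by
    rw [Nat.cast_choose ℚ hin]
    have := Nat.factorial_ne_zero n
    have := Nat.factorial_ne_zero i
    have := Nat.factorial_ne_zero (n - i)
    field_simp
  rw [coeff_egf, coeff_egf, hc]
  calc _ = C ((i.factorial : ℚ)⁻¹ * ((n - i).factorial : ℚ)⁻¹) * (a i * b (n - i)) := by
        rw [C_mul]; ring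
    _ = _ := by rw [h1, C_mul]; ring

lemma egf_one : egf (fun _ => 1) = PowerSeries.exp ℚ[X] := by
  ext1 n
  rw [coeff_egf, PowerSeries.coeff_exp, mul_one, one_div, Polynomial.algebraMap_eq]

lemma rescale_egf (c : ℚ) (a : ℕ → ℚ[X]) :
    PowerSeries.rescale (C c) (egf a) = egf fun n => C (c ^ n) * a n := by
  ext1 n
  rw [PowerSeries.coeff_rescale, coeff_egf, coeff_egf, C_pow]
  ring

/-! ### The derivation attached to recurrences of Eulerian type. -/

/-- Coefficientwise differentiation in the variable of the coefficient ring. -/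
noncomputable def coeffDeriv (f : PowerSeries ℚ[X]) : PowerSeries ℚ[X] :=
  PowerSeries.mk fun n => derivative (PowerSeries.coeff n f)

lemma coeffDeriv_mul (f g : PowerSeries ℚ[X]) :
    coeffDeriv (f * g) = coeffDeriv f * g + f * coeffDeriv g := by
  ext1 n
  simp only [coeffDeriv, PowerSeries.coeff_mk, map_add, PowerSeries.coeff_mul, map_sum,
    derivative_mul, Finset.sum_add_distrib]

/-- The derivation `∂ₜ - x t ∂ₜ - x (1 - x) ∂ₓ` on `ℚ[x]⟦t⟧`. -/
noncomputable def eulerianDeriv (f : PowerSeries ℚ[X]) : PowerSeries ℚ[X] :=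
  PowerSeries.derivative ℚ[X] f
    - PowerSeries.C X * (PowerSeries.X * PowerSeries.derivative ℚ[X] f)
    - PowerSeries.C (X * (1 - X)) * coeffDeriv f

lemma eulerianDeriv_mul (f g : PowerSeries ℚ[X]) :
    eulerianDeriv (f * g) = eulerianDeriv f * g + f * eulerianDeriv g := by
  simp only [eulerianDeriv, coeffDeriv_mul, Derivation.leibniz, smul_eq_mul]
  ring

lemma coeff_eulerianDeriv (f : PowerSeries ℚ[X]) (n : ℕ) :
    PowerSeries.coeff n (eulerianDeriv f) =
      ((n : ℚ[X]) + 1) * PowerSeries.coeff (n + 1) f - X * (n : ℚ[X]) * PowerSeries.coeff n f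
        - X * (1 - X) * derivative (PowerSeries.coeff n f) := by
  have h : PowerSeries.coeff n (PowerSeries.X * PowerSeries.derivative ℚ[X] f) =
      (n : ℚ[X]) * PowerSeries.coeff n f := by
    cases n with
    | zero => simp
    | succ n =>
      rw [PowerSeries.coeff_succ_X_mul, PowerSeries.coeff_derivative]
      push_cast
      ring
  rw [eulerianDeriv, map_sub, map_sub, PowerSeries.coeff_C_mul, PowerSeries.coeff_C_mul, h,
    PowerSeries.coeff_derivative]
  simp only [coeffDeriv, PowerSeries.coeff_mk]
  ring

/-- Translates recurrences `a (n + 1) = X * n * a n + X * (1 - X) * (a n)' + ...` into differential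
equations for `egf a`. -/
lemma coeff_eulerianDeriv_egf (a : ℕ → ℚ[X]) (n : ℕ) :
    PowerSeries.coeff n (eulerianDeriv (egf a)) =
      C ((n.factorial : ℚ)⁻¹) * (a (n + 1) - X * (n : ℚ[X]) * a n - X * (1 - X) * derivative (a n)) := by
  have h : ((n : ℚ[X]) + 1) * C (((n + 1).factorial : ℚ)⁻¹) = C ((n.factorial : ℚ)⁻¹) := by
    have h2 : ((n : ℚ[X]) + 1) = C ((n : ℚ) + 1) := by simp
    rw [h2, ← C_mul, Nat.factorial_succ]
    congr 1
    have := Nat.factorial_ne_zero n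
    push_cast
    field_simp
  rw [coeff_eulerianDeriv, coeff_egf, coeff_egf, ← mul_assoc, h, derivative_C_mul]
  ring

lemma coeff_succ_X_mul_egf (a : ℕ → ℚ[X]) (n : ℕ) :
    PowerSeries.coeff (n + 1) (PowerSeries.X * egf a) =
      C (((n + 1).factorial : ℚ)⁻¹) * (((n : ℚ[X]) + 1) * a n) := by
  have h : C (((n + 1).factorial : ℚ)⁻¹) * ((n : ℚ[X]) + 1) = C ((n.factorial : ℚ)⁻¹) := by
    have h2 : ((n : ℚ[X]) + 1) = C ((n : ℚ) + 1) := by simp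
    rw [h2, ← C_mul, Nat.factorial_succ]
    congr 1
    have := Nat.factorial_ne_zero n
    push_cast
    field_simp
  rw [PowerSeries.coeff_succ_X_mul, coeff_egf, ← mul_assoc, h]

lemma eulerianDeriv_exp :
    eulerianDeriv (PowerSeries.exp ℚ[X]) =
      (1 - PowerSeries.C X * PowerSeries.X) * PowerSeries.exp ℚ[X] := by
  ext1 n
  rw [← egf_one, coeff_eulerianDeriv_egf, sub_mul, one_mul, map_sub,
    mul_assoc (PowerSeries.C X), PowerSeries.coeff_C_mul, coeff_egf]
  cases n with
  | zero => simp
  | succ n =>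
    rw [coeff_succ_X_mul_egf, derivative_one]
    push_cast
    ring

/-- A solution of `eulerianDeriv f = c * f` is determined by its constant coefficient. -/
lemma eq_of_eulerianDeriv_eq {c f g : PowerSeries ℚ[X]} (hf : eulerianDeriv f = c * f)
    (hg : eulerianDeriv g = c * g)
    (h0 : PowerSeries.coeff 0 f = PowerSeries.coeff 0 g) : f = g := by
  ext1 n
  induction n using Nat.strong_induction_on with
  | _ n ih =>
    cases n with
    | zero => exact h0
    | succ n =>
      -- The coefficient of index `n + 1` enters the `n`-th equation only through `(n + 1) * coeff
      -- (n + 1)`; every other term involves indices at most `n`.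
      have hfn := congrArg (PowerSeries.coeff n) hf
      have hgn := congrArg (PowerSeries.coeff n) hg
      have hc : PowerSeries.coeff n (c * f) = PowerSeries.coeff n (c * g) := by
        rw [PowerSeries.coeff_mul, PowerSeries.coeff_mul]
        refine Finset.sum_congr rfl fun p hp => ?_
        rw [ih p.2 (Nat.lt_succ_of_le (by have := Finset.HasAntidiagonal.mem_antidiagonal.mp hp; omega))]
      rw [coeff_eulerianDeriv] at hfn hgn
      rw [ih n n.lt_succ_self] at hfn
      refine mul_left_cancel₀ (a := (n : ℚ[X]) + 1) (by exact_mod_cast n.succ_ne_zero) ?_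
      linear_combination hfn - hgn + hc

/-! ### Ascents and successions under insertion of a maximum. -/

/-- The number of ascents of a word. -/
def listAsc : List ℕ → ℕ
  | [] => 0
  | [_] => 0
  | a :: b :: l => (if a < b then 1 else 0) + listAsc (b :: l)

/-- The number of successions of a word. -/
def listSucc : List ℕ → ℕ
  | [] => 0
  | [_] => 0
  | a :: b :: l => (if b = a + 1 then 1 else 0) + listSucc (b :: l)

/-- Insertion of a new maximum behind the first letter of a word: the joint distribution of ascents
and successions. -/
lemma sum_insert_max_tail (M : ℕ) (l : List ℕ) : ∀ (c : ℕ) (f : ℕ → ℕ → ℚ[X]),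
    (∀ a ∈ c :: l, a < M) →
    ((List.permutations'Aux M l).map fun t => f (listAsc (c :: t)) (listSucc (c :: t))).sum
      + ((c :: l).count (M - 1) : ℚ[X]) * f (listAsc (c :: l) + 1) (listSucc (c :: l)) =
    ((listAsc (c :: l) : ℚ[X]) - listSucc (c :: l)) * f (listAsc (c :: l)) (listSucc (c :: l))
      + (listSucc (c :: l) : ℚ[X]) * f (listAsc (c :: l)) (listSucc (c :: l) - 1)
      + (((c :: l).length : ℚ[X]) - listAsc (c :: l)) * f (listAsc (c :: l) + 1) (listSucc (c :: l))
      + ((c :: l).count (M - 1) : ℚ[X]) * f (listAsc (c :: l) + 1) (listSucc (c :: l) + 1) := by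
  induction l with
  | nil =>
    intro c f h
    have hc : c < M := h c (by simp)
    by_cases hM : M = c + 1
    · subst hM
      simp [listAsc, listSucc, List.permutations'Aux]
      ring
    · have h1 : ¬ c = M - 1 := by omega
      simp [listAsc, listSucc, List.permutations'Aux, hc, hM, h1]
  | cons d l ih =>
    intro c f h
    have hc : c < M := h c (by simp)
    have hd : d < M := h d (by simp)
    have hMd : ¬ M < d := by omega
    have hMd' : ¬ d = M + 1 := by omega
    -- The weight `f` is arbitrary so that it can absorb the contribution of the pair `c, d`.
    -- Insertion into an ascent keeps the ascent number and breaks a succession if one is there; any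
    -- other gap gains an ascent. A gap behind `M - 1` is never an ascent and gains a succession as
    -- well, which the two `count` terms correct for.
    have key := ih d (fun a s => f ((if c < d then 1 else 0) + a) ((if d = c + 1 then 1 else 0) + s))
      (fun a ha => h a (List.mem_cons_of_mem _ ha))
    simp only [List.permutations'Aux, List.map_cons, List.sum_cons, List.map_map,
      Function.comp_def, listAsc, listSucc, hc, if_true, hMd, hMd', if_false, zero_add]
    rw [List.count_cons, List.length_cons]
    set A := listAsc (d :: l)
    set s := listSucc (d :: l)
    set k := List.count (M - 1) (d :: l)
    set len := (d :: l).length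
    simp only [beq_iff_eq]
    by_cases h1 : d = c + 1
    · have h2 : c < d := by omega
      have h3 : ¬ M = c + 1 := by omega
      have h4 : ¬ c = M - 1 := by omega
      simp only [h1, h3, h4, if_true, if_false, Nat.lt_succ_self, add_zero] at key ⊢
      -- At `s = 0` the subtraction `s - 1` is truncated, but its term has coefficient `s`.
      rcases Nat.eq_zero_or_pos s with h0 | h0
      · rw [h0] at key ⊢
        simp only [add_comm 1, zero_add] at key ⊢
        push_cast at key ⊢
        linear_combination key
      · have h5 : 1 + (s - 1) = 1 + s - 1 := by omega
        rw [h5] at key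
        simp only [add_comm 1, Nat.add_sub_cancel, zero_add] at key ⊢
        push_cast at key ⊢
        linear_combination key
    · by_cases h2 : c < d
      · have h3 : ¬ M = c + 1 := by omega
        have h4 : ¬ c = M - 1 := by omega
        simp only [h1, h2, h3, h4, if_true, if_false, zero_add, add_zero] at key ⊢
        simp only [add_comm 1] at key ⊢
        push_cast at key ⊢
        linear_combination key
      · by_cases h3 : M = c + 1
        · have h4 : c = M - 1 := by omega
          simp only [h1, h2, eq_true h3, eq_true h4, if_true, if_false, zero_add] at key ⊢
          simp only [add_comm 1] at key ⊢
          push_cast at key ⊢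
          linear_combination key
        · have h4 : ¬ c = M - 1 := by omega
          simp only [h1, h2, h3, h4, if_false, zero_add, add_zero] at key ⊢
          simp only [add_comm 1] at key ⊢
          push_cast at key ⊢
          linear_combination key

/-- The decreasing word `n - 1, …, 1, 0`. -/
def descWord : ℕ → List ℕ
  | 0 => []
  | n + 1 => n :: descWord n

lemma length_descWord (n : ℕ) : (descWord n).length = n := by
  induction n with
  | zero => rfl
  | succ n ih => simp [descWord, ih]

lemma mem_descWord {n a : ℕ} : a ∈ descWord n ↔ a < n := by
  induction n with
  | zero => simp [descWord]
  | succ n ih => simp [descWord, ih]; omega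

lemma nodup_descWord (n : ℕ) : (descWord n).Nodup := by
  induction n with
  | zero => simp [descWord]
  | succ n ih => simp [descWord, ih, mem_descWord]

/-- The first summand is insertion at the front, which creates a descent and changes neither
statistic. The letter `n` occurs once, so exactly one gap creates a succession. -/
lemma sum_insert_max {n : ℕ} {t : List ℕ} (ht : t.Perm (descWord (n + 1))) (f : ℕ → ℕ → ℚ[X]) :
    ((List.permutations'Aux (n + 1) t).map fun t => f (listAsc t) (listSucc t)).sum =
      f (listAsc t) (listSucc t)
      + ((listAsc t : ℚ[X]) - listSucc t) * f (listAsc t) (listSucc t)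
      + (listSucc t : ℚ[X]) * f (listAsc t) (listSucc t - 1)
      + ((n : ℚ[X]) - listAsc t) * f (listAsc t + 1) (listSucc t)
      + f (listAsc t + 1) (listSucc t + 1) := by
  have hlt : ∀ a ∈ t, a < n + 1 := fun a ha => mem_descWord.mp (ht.mem_iff.mp ha)
  have hlen : t.length = n + 1 := by rw [ht.length_eq, length_descWord]
  have hcount : t.count n = 1 :=
    List.count_eq_one_of_mem (ht.nodup_iff.mpr (nodup_descWord _))
      (ht.mem_iff.mpr (mem_descWord.mpr n.lt_succ_self))
  cases t with
  | nil => simp at hlen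
  | cons c l =>
    have hc : c < n + 1 := hlt c (by simp)
    have key := sum_insert_max_tail (n + 1) l c f hlt
    rw [Nat.add_sub_cancel, hcount, hlen] at key
    have h1 : ¬ n + 1 < c := by omega
    have h2 : ¬ c = n + 1 + 1 := by omega
    simp only [List.permutations'Aux, List.map_cons, List.sum_cons, List.map_map,
      Function.comp_def]
    rw [show listAsc ((n + 1) :: c :: l) = listAsc (c :: l) by simp [listAsc, h1],
      show listSucc ((n + 1) :: c :: l) = listSucc (c :: l) by simp [listSucc, h2]]
    push_cast at key
    linear_combination key

/-- The words on the letters `0, …, n - 1`, each used once. -/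
def words (n : ℕ) : Finset (List ℕ) := (descWord n).permutations'.toFinset

lemma mem_words {n : ℕ} {t : List ℕ} : t ∈ words n ↔ t.Perm (descWord n) := by
  rw [words, List.mem_toFinset, List.mem_permutations']

lemma nodup_permutations'_descWord (n : ℕ) : (descWord n).permutations'.Nodup :=
  (List.permutations_perm_permutations' _).nodup_iff.mp
    (List.nodup_permutations _ (nodup_descWord n))

lemma sum_map_flatMap (L : List (List ℕ)) (g : List ℕ → List (List ℕ)) (h : List ℕ → ℚ[X]) :
    ((L.flatMap g).map h).sum = (L.map fun t => ((g t).map h).sum).sum := by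
  induction L with
  | nil => simp
  | cons a L ih => simp [List.flatMap_cons, ih]

/-- `List.permutations'` inserts the head of a list into the permutations of its tail; as `descWord`
is decreasing, the inserted letter is the maximum. -/
lemma sum_words_succ (n : ℕ) (h : List ℕ → ℚ[X]) :
    ∑ t ∈ words (n + 1), h t = ∑ t ∈ words n, ((List.permutations'Aux n t).map h).sum := by
  rw [words, words, List.sum_toFinset _ (nodup_permutations'_descWord _),
    List.sum_toFinset _ (nodup_permutations'_descWord _), descWord, List.permutations',
    sum_map_flatMap]

/-! ### Recurrences for words with a given number of successions. -/

/-- The ascent polynomial of the words on `n + 1` letters with exactly `b` successions. -/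
noncomputable def succPoly (n b : ℕ) : ℚ[X] :=
  ∑ t ∈ words (n + 1), if listSucc t = b then X ^ listAsc t else 0

lemma X_mul_derivative_X_pow (n : ℕ) :
    X * derivative (X ^ n : ℚ[X]) = (n : ℚ[X]) * X ^ n := by
  cases n with
  | zero => simp
  | succ n => simp; ring

lemma succPoly_succ_zero (n : ℕ) :
    succPoly (n + 1) 0 = (1 + X * (n : ℚ[X])) * succPoly n 0
      + X * (1 - X) * derivative (succPoly n 0) + succPoly n 1 := by
  rw [succPoly, sum_words_succ, succPoly, succPoly, derivative_sum, Finset.mul_sum,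
    Finset.mul_sum, ← Finset.sum_add_distrib, ← Finset.sum_add_distrib]
  refine Finset.sum_congr rfl fun t ht => ?_
  rw [sum_insert_max (mem_words.mp ht) fun a s => if s = 0 then X ^ a else 0]
  rcases h : listSucc t with _ | _ | s
  · simp
    linear_combination (X - 1) * X_mul_derivative_X_pow (listAsc t)
  · simp
  · simp

lemma succPoly_succ_succ (n b : ℕ) :
    succPoly (n + 1) (b + 1) = (X * (n : ℚ[X]) - (b : ℚ[X])) * succPoly n (b + 1)
      + X * (1 - X) * derivative (succPoly n (b + 1)) + X * succPoly n b
      + ((b : ℚ[X]) + 2) * succPoly n (b + 2) := by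
  rw [succPoly, sum_words_succ]
  simp only [succPoly]
  rw [derivative_sum, Finset.mul_sum, Finset.mul_sum, Finset.mul_sum, Finset.mul_sum,
    ← Finset.sum_add_distrib, ← Finset.sum_add_distrib, ← Finset.sum_add_distrib]
  refine Finset.sum_congr rfl fun t ht => ?_
  rw [sum_insert_max (mem_words.mp ht) fun a s => if s = b + 1 then X ^ a else 0]
  have hd := X_mul_derivative_X_pow (listAsc t)
  by_cases h1 : listSucc t = b + 1
  · simp [h1]
    linear_combination (X - 1) * hd
  · by_cases h2 : listSucc t = b
    · have : ¬ b - 1 = b + 1 := by omega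
      simp [h2, pow_succ', this]
    · by_cases h3 : listSucc t = b + 2
      · simp [h3]
      · have : ¬ listSucc t - 1 = b + 1 := by omega
        simp [h1, h2, h3, this]

lemma succPoly_zero_succ (b : ℕ) : succPoly 0 (b + 1) = 0 := by
  simp [succPoly, words, descWord, listSucc]

/-- Collapsing one of the successions of a word. -/
lemma succ_mul_succPoly (n : ℕ) : ∀ b : ℕ,
    ((b : ℚ[X]) + 1) * succPoly (n + 1) (b + 1) = ((n : ℚ[X]) + 1) * X * succPoly n b := by
  induction n with
  | zero =>
    intro b
    rw [succPoly_succ_succ, succPoly_zero_succ, succPoly_zero_succ]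
    cases b with
    | zero => simp
    | succ b => simp [succPoly_zero_succ]
  | succ n ih =>
    intro b
    have h0 := ih b
    have h1 := ih (b + 1)
    -- The induction is algebraic: the insertion recurrence for `succPoly (n + 2) (b + 1)` contains
    -- the derivative of `succPoly (n + 1) (b + 1)`, which comes from differentiating the induction
    -- hypothesis.
    have hd := congrArg derivative h0
    simp only [derivative_mul, derivative_add, derivative_natCast, derivative_one, derivative_X,
      add_zero, zero_mul, zero_add, mul_one] at hd
    have hr := succPoly_succ_succ (n + 1) b
    cases b with
    | zero =>
      have hz := succPoly_succ_zero n
      push_cast at *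
      linear_combination hr + (X * ((n : ℚ[X]) + 1)) * h0 + X * (1 - X) * hd + h1
        - ((n : ℚ[X]) + 1) * X * hz
    | succ c =>
      have hz := succPoly_succ_succ n c
      have hc := ih c
      push_cast at *
      linear_combination ((c : ℚ[X]) + 2) * hr + (X * ((n : ℚ[X]) + 1) - (c + 1)) * h0
        + X * (1 - X) * hd + ((c : ℚ[X]) + 2) * h1 - ((n : ℚ[X]) + 1) * X * hz + X * hc

lemma succPoly_zero_zero : succPoly 0 0 = 1 := by
  simp [succPoly, words, descWord, listAsc, listSucc]

/-! ### Permutations as words, and the recurrence for `S`. -/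

lemma card_ascents_eq_listAsc : ∀ {n : ℕ} (f : Fin n → ℕ),
    (Finset.univ.filter fun i : Fin n => ∃ h : (i : ℕ) + 1 < n, f i < f ⟨(i : ℕ) + 1, h⟩).card =
      listAsc (List.ofFn f)
  | 0, f => by simp [listAsc]
  | 1, f => by
    rw [List.ofFn_succ, List.ofFn_zero, listAsc, Finset.card_eq_zero,
      Finset.filter_eq_empty_iff]
    rintro i _ ⟨h, _⟩
    omega
  | n + 2, f => by
    have ih := card_ascents_eq_listAsc fun i : Fin (n + 1) => f i.succ
    have h0 : (∃ h : ((0 : Fin (n + 2)) : ℕ) + 1 < n + 2,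
        f 0 < f ⟨((0 : Fin (n + 2)) : ℕ) + 1, h⟩) ↔ f 0 < f (Fin.succ 0) :=
      ⟨fun ⟨_, h⟩ => h, fun h => ⟨by simp, h⟩⟩
    have hs : ∀ i : Fin (n + 1), (∃ h : (i.succ : ℕ) + 1 < n + 2,
        f i.succ < f ⟨(i.succ : ℕ) + 1, h⟩) ↔
        ∃ h : (i : ℕ) + 1 < n + 1, f i.succ < f (Fin.succ ⟨(i : ℕ) + 1, h⟩) := fun i =>
      ⟨fun ⟨h, h'⟩ => ⟨Nat.lt_of_succ_lt_succ h, h'⟩, fun ⟨h, h'⟩ => ⟨Nat.succ_lt_succ h, h'⟩⟩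
    rw [Fin.card_filter_univ_succ]
    simp only [h0, hs]
    rw [ih, List.ofFn_succ (f := f), List.ofFn_succ, listAsc]
    split_ifs <;> omega

lemma listSucc_ofFn_eq_zero_iff : ∀ {n : ℕ} (f : Fin n → ℕ),
    listSucc (List.ofFn f) = 0 ↔
      ∀ i : Fin n, ¬ ∃ h : (i : ℕ) + 1 < n, f ⟨(i : ℕ) + 1, h⟩ = f i + 1
  | 0, f => by simp [listSucc]
  | 1, f => by
    rw [List.ofFn_succ, List.ofFn_zero, listSucc]
    refine ⟨fun _ i ⟨h, _⟩ => ?_, fun _ => rfl⟩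
    omega
  | n + 2, f => by
    have ih := listSucc_ofFn_eq_zero_iff fun i : Fin (n + 1) => f i.succ
    have h0 : (∃ h : ((0 : Fin (n + 2)) : ℕ) + 1 < n + 2,
        f ⟨((0 : Fin (n + 2)) : ℕ) + 1, h⟩ = f 0 + 1) ↔ f (Fin.succ 0) = f 0 + 1 :=
      ⟨fun ⟨_, h⟩ => h, fun h => ⟨by simp, h⟩⟩
    have hs : ∀ i : Fin (n + 1), (∃ h : (i.succ : ℕ) + 1 < n + 2,
        f ⟨(i.succ : ℕ) + 1, h⟩ = f i.succ + 1) ↔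
        ∃ h : (i : ℕ) + 1 < n + 1, f (Fin.succ ⟨(i : ℕ) + 1, h⟩) = f i.succ + 1 := fun i =>
      ⟨fun ⟨h, h'⟩ => ⟨Nat.lt_of_succ_lt_succ h, h'⟩, fun ⟨h, h'⟩ => ⟨Nat.succ_lt_succ h, h'⟩⟩
    rw [Fin.forall_fin_succ]
    simp only [h0, hs]
    rw [← ih, List.ofFn_succ (f := f), List.ofFn_succ, listSucc]
    split_ifs with h <;> simp only [h] <;> simp

lemma ofFn_perm_descWord {n : ℕ} (π : Equiv.Perm (Fin n)) :
    (List.ofFn fun i => (π i : ℕ)).Perm (descWord n) := by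
  rw [List.perm_ext_iff_of_nodup
    (List.nodup_ofFn.mpr fun i j h => π.injective (Fin.val_injective h)) (nodup_descWord n)]
  intro a
  rw [List.mem_ofFn, mem_descWord]
  constructor
  · rintro ⟨i, rfl⟩
    exact (π i).isLt
  · intro h
    exact ⟨π.symm ⟨a, h⟩, by simp⟩

lemma sum_perm_ofFn (n : ℕ) (g : List ℕ → ℚ[X]) :
    ∑ π : Equiv.Perm (Fin n), g (List.ofFn fun i => (π i : ℕ)) = ∑ t ∈ words n, g t := by
  refine Finset.sum_nbij (fun π => List.ofFn fun i => (π i : ℕ)) ?_ ?_ ?_ fun _ _ => rfl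
  · exact fun π _ => mem_words.mpr (ofFn_perm_descWord π)
  · intro π _ τ _ h
    ext i
    exact congrFun (List.ofFn_injective h) i
  · intro t ht
    have ht := mem_words.mp ht
    have hlen : t.length = n := by rw [ht.length_eq, length_descWord]
    subst hlen
    have hnd : t.Nodup := ht.nodup_iff.mpr (nodup_descWord _)
    let f : Fin t.length → Fin t.length := fun i =>
      ⟨t.get i, mem_descWord.mp (ht.mem_iff.mp (t.get_mem i))⟩
    have hf : Function.Injective f := fun i j h =>
      List.nodup_iff_injective_get.mp hnd (congrArg Fin.val h)
    refine ⟨Equiv.ofBijective f (Finite.injective_iff_bijective.mp hf), Finset.mem_univ _, ?_⟩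
    exact List.ofFn_get t

open Classical in
lemma S_eq_succPoly (n : ℕ) : S n = succPoly n 0 := by
  rw [S, succPoly, ← sum_perm_ofFn, Finset.sum_filter]
  refine Finset.sum_congr rfl fun π _ => ?_
  have h1 := listSucc_ofFn_eq_zero_iff fun i => (π i : ℕ)
  have h2 := card_ascents_eq_listAsc fun i => (π i : ℕ)
  have h3 : asc π = listAsc (List.ofFn fun i => (π i : ℕ)) := h2
  rw [h3]
  by_cases h4 : ∀ i, ¬ IsSuccession π i
  · rw [if_pos h4, if_pos (h1.mpr h4)]
  · rw [if_neg h4, if_neg (fun h => h4 (h1.mp h))]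

lemma S_zero : S 0 = 1 := by rw [S_eq_succPoly, succPoly_zero_zero]

lemma S_one : S 1 = 1 := by
  rw [S_eq_succPoly, succPoly_succ_zero, succPoly_zero_zero]
  simp [succPoly, words, descWord, listSucc]

/-- Inserting a maximum yields no successions only from words with none, or with a single one that
it breaks; collapsing that one turns `succPoly (n + 1) 1` into `(n + 1) * X * S n`. -/
lemma S_succ_succ (n : ℕ) :
    S (n + 2) = (1 + X * ((n : ℚ[X]) + 1)) * S (n + 1) + X * (1 - X) * derivative (S (n + 1))
      + ((n : ℚ[X]) + 1) * X * S n := by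
  have h := succ_mul_succPoly n 0
  have h2 := succPoly_succ_zero (n + 1)
  simp only [S_eq_succPoly]
  push_cast at h h2
  linear_combination h2 + h

lemma eulerianDeriv_egf_S :
    eulerianDeriv (egf S) = (1 + PowerSeries.C X * PowerSeries.X) * egf S := by
  ext1 n
  rw [coeff_eulerianDeriv_egf, add_mul, one_mul, map_add, mul_assoc (PowerSeries.C X),
    PowerSeries.coeff_C_mul, coeff_egf]
  cases n with
  | zero => simp [S_zero, S_one]
  | succ n =>
    rw [coeff_succ_X_mul_egf, S_succ_succ]
    push_cast
    ring

/-! ### The Eulerian recurrence for excedances. -/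

lemma exc_decomposeFin_symm_zero {n : ℕ} (σ : Equiv.Perm (Fin n)) :
    exc (Equiv.Perm.decomposeFin.symm (0, σ)) = exc σ := by
  simp [exc, Fin.card_filter_univ_succ]

/-- The new point `0` is inserted into the cycle of `σ` between `j` and `σ j`: position `0` becomes
an excedance, and position `j.succ`, now mapped to `0`, is not one. -/
lemma exc_decomposeFin_symm_succ {n : ℕ} (σ : Equiv.Perm (Fin n)) (j : Fin n) :
    exc (Equiv.Perm.decomposeFin.symm ((σ j).succ, σ)) =
      if j < σ j then exc σ else exc σ + 1 := by
  have h : ∀ i : Fin n, (i.succ < Equiv.swap 0 (σ j).succ (σ i).succ) ↔ (i < σ i ∧ i ≠ j) := by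
    intro i
    by_cases hij : i = j
    · subst hij
      simp
    · rw [Equiv.swap_apply_of_ne_of_ne (Fin.succ_ne_zero _)
        (fun h => hij (σ.injective (Fin.succ_injective _ h)))]
      simp [hij]
  have h2 : (Finset.univ.filter fun i : Fin n => i < σ i ∧ i ≠ j) =
      (Finset.univ.filter fun i : Fin n => i < σ i).erase j := by
    ext i
    simp [and_comm]
  rw [exc, Fin.card_filter_univ_succ]
  simp only [Equiv.Perm.decomposeFin_symm_apply_zero, Fin.succ_pos, if_true,
    Equiv.Perm.decomposeFin_symm_apply_succ, h]
  rw [h2, Finset.card_erase_eq_ite]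
  simp only [Finset.mem_filter, Finset.mem_univ, true_and]
  split_ifs with hj
  · exact Nat.succ_pred_eq_of_pos (Finset.card_pos.mpr ⟨j, by simpa using hj⟩)
  · rfl

lemma sum_exc_decomposeFin {n : ℕ} (σ : Equiv.Perm (Fin n)) :
    ∑ p, (X : ℚ[X]) ^ exc (Equiv.Perm.decomposeFin.symm (p, σ)) =
      X ^ exc σ + (exc σ : ℚ[X]) * X ^ exc σ + ((n : ℚ[X]) - (exc σ : ℚ[X])) * X ^ (exc σ + 1) := by
  have hle : exc σ ≤ n := by
    simpa [exc] using Finset.card_filter_le (Finset.univ : Finset (Fin n)) (fun i => i < σ i)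
  have hc : (Finset.univ.filter fun i : Fin n => ¬ i < σ i).card = n - exc σ := by
    have := Finset.card_filter_add_card_filter_not (s := (Finset.univ : Finset (Fin n)))
      (fun i => i < σ i)
    rw [Finset.card_univ, Fintype.card_fin] at this
    rw [exc]
    omega
  rw [Fin.sum_univ_succ, exc_decomposeFin_symm_zero, ← Equiv.sum_comp σ]
  simp only [exc_decomposeFin_symm_succ]
  rw [Finset.sum_congr rfl fun j _ => apply_ite (fun k => (X : ℚ[X]) ^ k) (j < σ j) _ _,
    Finset.sum_ite, Finset.sum_const, Finset.sum_const, hc, nsmul_eq_mul, nsmul_eq_mul,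
    Nat.cast_sub hle, add_assoc]
  rfl

lemma eulerian_succ (n : ℕ) :
    eulerian (n + 1) =
      (1 + X * (n : ℚ[X])) * eulerian n + X * (1 - X) * derivative (eulerian n) := by
  rw [eulerian, ← Equiv.sum_comp Equiv.Perm.decomposeFin.symm, Fintype.sum_prod_type_right]
  simp only [sum_exc_decomposeFin]
  rw [eulerian, derivative_sum, Finset.mul_sum, Finset.mul_sum, ← Finset.sum_add_distrib]
  refine Finset.sum_congr rfl fun σ _ => ?_
  linear_combination (X - 1) * X_mul_derivative_X_pow (exc σ)

lemma eulerianDeriv_egf_eulerian : eulerianDeriv (egf eulerian) = egf eulerian := by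
  ext1 n
  rw [coeff_eulerianDeriv_egf, coeff_egf, eulerian_succ]
  ring

/-! ### Excedances sorted by fixed points, and the formula for `egf S`. -/

/-- Excedances of a permutation of `α` with respect to the order given by `v`. -/
def excOn {α : Type*} [Fintype α] (v : α → ℤ) (σ : Equiv.Perm α) : ℕ :=
  (Finset.univ.filter fun i => v i < v (σ i)).card

open Classical in
lemma sum_derangements_excOn {α : Type*} [Fintype α] [DecidableEq α] (v : α → ℤ) (hv : Function.Injective v) :
    ∑ σ : Equiv.Perm α with σ ∈ derangements α, (X : ℚ[X]) ^ excOn v σ =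
      derangementPoly (Fintype.card α) := by
  let _ : LinearOrder α := LinearOrder.lift' v hv
  let e : Fin (Fintype.card α) ≃o α := Fintype.orderIsoFinOfCardEq α rfl
  have he : ∀ i j, v (e i) < v (e j) ↔ i < j := fun i j => e.lt_iff_lt
  rw [derangementPoly]
  refine (Finset.sum_equiv e.toEquiv.permCongr ?_ ?_).symm
  · intro σ
    rw [Finset.mem_filter, Finset.mem_filter, and_iff_right (Finset.mem_univ _),
      and_iff_right (Finset.mem_univ _)]
    change (∀ x, σ x ≠ x) ↔ ∀ x, e.toEquiv.permCongr σ x ≠ x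
    constructor
    · intro h x hx
      exact h (e.symm x) (e.injective (by simpa [Equiv.permCongr_apply] using hx))
    · intro h x hx
      exact h (e x) (by simp [Equiv.permCongr_apply, hx])
  · intro σ _
    congr 1
    rw [exc, excOn]
    refine Finset.card_equiv e.toEquiv fun i => ?_
    rw [Finset.mem_filter, Finset.mem_filter]
    simp [Equiv.permCongr_apply, he]

-- Deleting the fixed points leaves a derangement of the complement of `T`, and a fixed point is
-- never an excedance. Allowing any injective `v` makes this apply to signed orders too.
open Classical in
lemma sum_fixedPoints_eq_excOn {α : Type*} [Fintype α] [DecidableEq α] (v : α → ℤ) (hv : Function.Injective v)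
    (T : Finset α) :
    ∑ σ : Equiv.Perm α with (Finset.univ.filter fun i => σ i = i) = T, (X : ℚ[X]) ^ excOn v σ =
      derangementPoly (Fintype.card α - T.card) := by
  have hcard : Fintype.card {a // a ∉ T} = Fintype.card α - T.card := by
    rw [Fintype.card_subtype_compl, Fintype.card_coe]
  rw [← hcard, ← sum_derangements_excOn (fun a : {a // a ∉ T} => v a)
    (hv.comp Subtype.val_injective)]
  symm
  refine Finset.sum_nbij (fun g => Equiv.Perm.ofSubtype g) ?_ ?_ ?_ ?_
  · intro g hg
    simp only [Finset.mem_filter, Finset.mem_univ, true_and] at hg ⊢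
    ext a
    simp only [Finset.mem_filter, Finset.mem_univ, true_and]
    by_cases ha : a ∈ T
    · simp [Equiv.Perm.ofSubtype_apply_of_not_mem g (not_not.mpr ha), ha]
    · rw [Equiv.Perm.ofSubtype_apply_of_mem g ha]
      refine iff_of_false (fun h => hg ⟨a, ha⟩ (Subtype.ext h)) ha
  · exact Equiv.Perm.ofSubtype_injective.injOn
  · intro σ hσ
    simp only [Finset.coe_filter, Finset.mem_univ, true_and, Set.mem_ofPred_eq] at hσ
    have hfix : ∀ a, a ∈ T ↔ σ a = a := fun a => by rw [← hσ]; simp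
    -- By injectivity `σ a` is fixed only when `a` is, so `σ` restricts to the complement of `T`.
    have h1 : ∀ a, a ∉ T ↔ σ a ∉ T := fun a => by
      rw [hfix, hfix, EmbeddingLike.apply_eq_iff_eq]
    refine ⟨σ.subtypePerm fun a => (h1 a).symm, ?_, ?_⟩
    · simp only [Finset.coe_filter, Finset.mem_univ, true_and, Set.mem_ofPred_eq]
      intro a ha
      exact a.2 ((hfix a).mpr (congrArg Subtype.val ha))
    · refine Equiv.Perm.ofSubtype_subtypePerm _ fun a ha hT => ha ((hfix a).mp hT)
  · intro g _
    congr 1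
    rw [excOn, excOn]
    refine Finset.card_nbij (fun a => (a : α)) ?_ Subtype.val_injective.injOn ?_
    · intro a ha
      simpa using ha
    · intro a ha
      simp only [Finset.coe_filter, Finset.mem_univ, true_and, Set.mem_ofPred_eq] at ha
      by_cases hT : a ∈ T
      · rw [Equiv.Perm.ofSubtype_apply_of_not_mem g (not_not.mpr hT)] at ha
        exact absurd ha (lt_irrefl _)
      · rw [Equiv.Perm.ofSubtype_apply_of_mem g hT] at ha
        exact ⟨⟨a, hT⟩, by simpa using ha, rfl⟩

open Classical in
/-- Permutations whose fixed points lie in `N`, sorted by their set of fixed points. -/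
lemma sum_fixedPoints_subset_excOn {α : Type*} [Fintype α] [DecidableEq α] (v : α → ℤ)
    (hv : Function.Injective v) (N : Finset α) :
    ∑ σ : Equiv.Perm α with ∀ i, σ i = i → i ∈ N, (X : ℚ[X]) ^ excOn v σ =
      ∑ T ∈ N.powerset, derangementPoly (Fintype.card α - T.card) := by
  rw [← Finset.sum_fiberwise_of_maps_to (s := Finset.univ.filter fun σ : Equiv.Perm α =>
    ∀ i, σ i = i → i ∈ N) (t := N.powerset) (g := fun σ => Finset.univ.filter fun i => σ i = i)]
  · refine Finset.sum_congr rfl fun T hT => ?_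
    rw [← sum_fixedPoints_eq_excOn v hv T, Finset.filter_filter]
    refine Finset.sum_congr (Finset.filter_congr fun σ _ => ?_) fun _ _ => rfl
    refine and_iff_right_of_imp ?_
    rintro rfl i hi
    exact Finset.mem_powerset.mp hT (by simpa using hi)
  · intro σ hσ
    simp only [Finset.mem_filter, Finset.mem_univ, true_and] at hσ
    rw [Finset.mem_powerset]
    intro i hi
    exact hσ i (by simpa using hi)

lemma eulerian_eq_sum_derangementPoly (n : ℕ) :
    eulerian n = ∑ k ∈ Finset.range (n + 1), (n.choose k : ℚ[X]) * 1 * derangementPoly (n - k) := by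
  have h := sum_fixedPoints_subset_excOn (fun i : Fin n => ((i : ℕ) : ℤ))
    (Nat.cast_injective.comp Fin.val_injective) Finset.univ
  have h2 := Finset.sum_powerset_apply_card (fun k => derangementPoly (n - k))
    (x := (Finset.univ : Finset (Fin n)))
  simp only [Fintype.card_fin] at h
  rw [h2, Finset.card_univ, Fintype.card_fin] at h
  simp only [nsmul_eq_mul, Finset.mem_univ, implies_true, Finset.filter_true] at h
  simp only [mul_one]
  rw [← h, eulerian]
  refine Finset.sum_congr rfl fun σ _ => ?_
  simp only [exc, excOn, Nat.cast_lt, Fin.val_fin_lt]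

lemma egf_eulerian : egf eulerian = PowerSeries.exp ℚ[X] * egf derangementPoly := by
  rw [← egf_one, egf_mul]
  exact congrArg egf (funext eulerian_eq_sum_derangementPoly)

/-- Apply the derivation to `egf_eulerian` by the product rule and cancel the exponential. -/
lemma eulerianDeriv_egf_derangementPoly :
    eulerianDeriv (egf derangementPoly) =
      PowerSeries.C X * PowerSeries.X * egf derangementPoly := by
  have h := eulerianDeriv_egf_eulerian
  rw [egf_eulerian, eulerianDeriv_mul, eulerianDeriv_exp] at h
  have h0 : PowerSeries.exp ℚ[X] ≠ 0 := fun h => by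
    have := congrArg (PowerSeries.coeff 0) h
    simp at this
  refine mul_left_cancel₀ h0 ?_
  linear_combination h

lemma eulerian_zero : eulerian 0 = 1 := by simp [eulerian, exc]

lemma derangementPoly_zero : derangementPoly 0 = 1 := by
  simp [derangementPoly, exc, derangements]

lemma egf_S : egf S = egf eulerian * egf derangementPoly := by
  refine eq_of_eulerianDeriv_eq eulerianDeriv_egf_S ?_ ?_
  · rw [eulerianDeriv_mul, eulerianDeriv_egf_eulerian, eulerianDeriv_egf_derangementPoly]
    ring
  · rw [egf_mul, coeff_egf, coeff_egf, S_zero]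
    simp [eulerian_zero, derangementPoly_zero]

/-! ### Signed permutations as pairs of a permutation and a set of negative values. -/

lemma PM.val_ne_zero {n : ℕ} (z : PM n) : z.1 ≠ 0 := (Finset.mem_erase.mp z.2).1

lemma PM.neg_neg {n : ℕ} (z : PM n) : z.neg.neg = z := Subtype.ext (_root_.neg_neg z.1)

/-- The positive letter `j + 1`. -/
def PM.pos {n : ℕ} (j : Fin n) : PM n :=
  ⟨(j : ℤ) + 1, by
    have h := j.isLt
    simp only [Finset.mem_erase, Finset.mem_Icc]
    omega⟩

/-- The index of the absolute value of a letter. -/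
def PM.idx {n : ℕ} (z : PM n) : Fin n :=
  ⟨z.1.natAbs - 1, by
    have h := z.2
    simp only [Finset.mem_erase, Finset.mem_Icc] at h
    omega⟩

lemma PM.idx_pos {n : ℕ} (j : Fin n) : (PM.pos j).idx = j := by
  ext
  simp only [PM.idx, PM.pos]
  omega

lemma PM.idx_neg {n : ℕ} (z : PM n) : z.neg.idx = z.idx := by
  simp [PM.idx, PM.neg]

lemma PM.zero_lt_pos {n : ℕ} (j : Fin n) : 0 < (PM.pos j).1 := by
  simp only [PM.pos]
  omega

lemma PM.zero_lt_neg {n : ℕ} (z : PM n) : 0 < z.neg.1 ↔ ¬ 0 < z.1 := by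
  have h := z.val_ne_zero
  simp only [PM.neg]
  omega

/-- Splits equalities of letters into an equality of indices and a propositional statement about
signs. -/
lemma PM.ext_idx {n : ℕ} {z z' : PM n} (h : z.idx = z'.idx) (hs : 0 < z.1 ↔ 0 < z'.1) :
    z = z' := by
  have h1 := z.val_ne_zero
  have h2 := z'.val_ne_zero
  have h3 := congrArg Fin.val h
  simp only [PM.idx] at h3
  apply Subtype.ext
  omega

lemma PM.eq_pos {n : ℕ} {z : PM n} (h : 0 < z.1) : z = PM.pos z.idx :=
  PM.ext_idx (PM.idx_pos _).symm (iff_of_true h (PM.zero_lt_pos _))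

lemma PM.abs_eq {n : ℕ} (z : PM n) : z.abs = PM.pos z.idx := by
  have h := z.val_ne_zero
  apply Subtype.ext
  simp only [PM.abs, PM.pos, PM.idx]
  omega

/-- The letter with index `j`, negative if `j ∈ N`. -/
def signedLetter {n : ℕ} (N : Finset (Fin n)) (j : Fin n) : PM n :=
  if j ∈ N then (PM.pos j).neg else PM.pos j

lemma idx_signedLetter {n : ℕ} (N : Finset (Fin n)) (j : Fin n) :
    (signedLetter N j).idx = j := by
  unfold signedLetter
  split_ifs
  · rw [PM.idx_neg, PM.idx_pos]
  · rw [PM.idx_pos]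

lemma zero_lt_signedLetter {n : ℕ} (N : Finset (Fin n)) (j : Fin n) :
    0 < (signedLetter N j).1 ↔ j ∉ N := by
  unfold signedLetter
  split_ifs with h
  · simp [PM.zero_lt_neg, PM.zero_lt_pos, h]
  · simp [PM.zero_lt_pos, h]

lemma signedLetter_val_injective {n : ℕ} (N : Finset (Fin n)) :
    Function.Injective fun j => (signedLetter N j).1 := fun i j h => by
  rw [← idx_signedLetter N i, ← idx_signedLetter N j, Subtype.ext h]

/-- The action on letters of the signed permutation with underlying permutation `σ` and set of
negative values `N`. -/
def signedMap {n : ℕ} (N : Finset (Fin n)) (σ : Equiv.Perm (Fin n)) (z : PM n) : PM n :=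
  if 0 < z.1 then signedLetter N (σ z.idx) else (signedLetter N (σ z.idx)).neg

lemma idx_signedMap {n : ℕ} (N : Finset (Fin n)) (σ : Equiv.Perm (Fin n)) (z : PM n) :
    (signedMap N σ z).idx = σ z.idx := by
  unfold signedMap
  split_ifs
  · rw [idx_signedLetter]
  · rw [PM.idx_neg, idx_signedLetter]

lemma zero_lt_signedMap {n : ℕ} (N : Finset (Fin n)) (σ : Equiv.Perm (Fin n)) (z : PM n) :
    0 < (signedMap N σ z).1 ↔ (0 < z.1 ↔ σ z.idx ∉ N) := by
  unfold signedMap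
  split_ifs with h
  · rw [zero_lt_signedLetter]
    tauto
  · rw [PM.zero_lt_neg, zero_lt_signedLetter]
    tauto

lemma signedMap_of_pos {n : ℕ} (N : Finset (Fin n)) (σ : Equiv.Perm (Fin n)) {z : PM n}
    (h : 0 < z.1) : signedMap N σ z = signedLetter N (σ z.idx) := if_pos h

lemma signedMap_neg {n : ℕ} (N : Finset (Fin n)) (σ : Equiv.Perm (Fin n)) (z : PM n) :
    signedMap N σ z.neg = (signedMap N σ z).neg := by
  refine PM.ext_idx ?_ ?_
  · rw [idx_signedMap, PM.idx_neg, PM.idx_neg, idx_signedMap]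
  · rw [zero_lt_signedMap, PM.zero_lt_neg, PM.zero_lt_neg, zero_lt_signedMap, PM.idx_neg]
    tauto

lemma signedMap_injective {n : ℕ} (N : Finset (Fin n)) (σ : Equiv.Perm (Fin n)) :
    Function.Injective (signedMap N σ) := by
  intro z z' h
  have h1 : z.idx = z'.idx := σ.injective (by rw [← idx_signedMap N, h, idx_signedMap])
  refine PM.ext_idx h1 ?_
  have h2 := zero_lt_signedMap N σ z
  rw [h, zero_lt_signedMap, h1] at h2
  tauto

/-- The signed permutation with underlying permutation `σ` and set of negative values `N`. -/
noncomputable def signedPerm {n : ℕ} (N : Finset (Fin n)) (σ : Equiv.Perm (Fin n)) :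
    Equiv.Perm (PM n) :=
  Equiv.ofBijective (signedMap N σ) (Finite.injective_iff_bijective.mp (signedMap_injective N σ))

lemma signedPerm_apply {n : ℕ} (N : Finset (Fin n)) (σ : Equiv.Perm (Fin n)) (z : PM n) :
    signedPerm N σ z = signedMap N σ z := rfl

lemma isDerangementB_signedPerm {n : ℕ} (N : Finset (Fin n)) (σ : Equiv.Perm (Fin n)) :
    IsDerangementB (signedPerm N σ) ↔ ∀ i, σ i = i → i ∈ N := by
  constructor
  · rintro ⟨_, h⟩ i hi
    by_contra hN
    refine h (PM.pos i) (PM.zero_lt_pos i) (PM.ext_idx ?_ ?_)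
    · rw [signedPerm_apply, idx_signedMap, PM.idx_pos, hi]
    · rw [signedPerm_apply, zero_lt_signedMap, PM.idx_pos, hi]
      tauto
  · intro h
    refine ⟨signedMap_neg N σ, fun z hz hfix => ?_⟩
    rw [signedPerm_apply] at hfix
    have h1 := idx_signedMap N σ z
    have h2 := zero_lt_signedMap N σ z
    rw [hfix] at h1 h2
    have h3 := h _ h1.symm
    rw [← h1] at h2
    tauto

/-- Put `k = |w(i)| = σ(i)`. Then `w(i)` is the signed letter of `k` and `w(|w(i)|)` that of `σ(k)`,
so type B excedances `i` correspond to excedances `k` of `σ` in the order of the signed letters. -/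
lemma excB_signedPerm {n : ℕ} (N : Finset (Fin n)) (σ : Equiv.Perm (Fin n)) :
    excB (signedPerm N σ) = excOn (fun j => (signedLetter N j).1) σ := by
  have key : ∀ z : PM n, 0 < z.1 →
      ((signedPerm N σ z).1 < (signedPerm N σ (signedPerm N σ z).abs).1 ↔
        (signedLetter N (σ z.idx)).1 < (signedLetter N (σ (σ z.idx))).1) := by
    intro z hz
    rw [PM.abs_eq, signedPerm_apply, signedPerm_apply, idx_signedMap,
      signedMap_of_pos N σ (PM.zero_lt_pos _), PM.idx_pos, signedMap_of_pos N σ hz]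
  rw [excB, excOn]
  refine Finset.card_nbij (fun z => σ z.idx) ?_ ?_ ?_
  · intro z hz
    have hz := (Finset.mem_filter.mp hz).2
    exact Finset.mem_filter.mpr ⟨Finset.mem_univ _, (key z hz.1).mp hz.2⟩
  · intro z hz z' hz' h
    have hz := (Finset.mem_filter.mp (Finset.mem_coe.mp hz)).2.1
    have hz' := (Finset.mem_filter.mp (Finset.mem_coe.mp hz')).2.1
    exact PM.ext_idx (σ.injective h) (iff_of_true hz hz')
  · intro j hj
    have hj := (Finset.mem_filter.mp (Finset.mem_coe.mp hj)).2
    have h1 : σ (PM.pos (σ.symm j)).idx = j := by rw [PM.idx_pos, Equiv.apply_symm_apply]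
    refine ⟨PM.pos (σ.symm j), Finset.mem_coe.mpr (Finset.mem_filter.mpr
      ⟨Finset.mem_univ _, PM.zero_lt_pos _, (key _ (PM.zero_lt_pos _)).mpr ?_⟩), h1⟩
    rwa [h1]

lemma signedPerm_injective {n : ℕ} :
    Function.Injective fun p : Finset (Fin n) × Equiv.Perm (Fin n) => signedPerm p.1 p.2 := by
  rintro ⟨N, σ⟩ ⟨N', σ'⟩ h
  have h1 : ∀ j, signedMap N σ (PM.pos j) = signedMap N' σ' (PM.pos j) := fun j =>
    Equiv.congr_fun h _
  have h2 : σ = σ' := by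
    ext1 j
    have h3 := congrArg PM.idx (h1 j)
    rwa [idx_signedMap, idx_signedMap, PM.idx_pos] at h3
  subst h2
  refine Prod.ext ?_ rfl
  ext j
  have h4 := zero_lt_signedMap N σ (PM.pos (σ.symm j))
  rw [h1, zero_lt_signedMap, PM.idx_pos, Equiv.apply_symm_apply] at h4
  have := PM.zero_lt_pos (σ.symm j)
  change j ∈ N ↔ j ∈ N'
  tauto

lemma exists_signedPerm_eq {n : ℕ} {w : Equiv.Perm (PM n)} (hw : IsSignedPerm w) :
    ∃ N σ, signedPerm N σ = w := by
  have hf : Function.Injective fun j => (w (PM.pos j)).idx := by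
    intro i j h
    by_cases hs : 0 < (w (PM.pos i)).1 ↔ 0 < (w (PM.pos j)).1
    · have h1 := congrArg PM.idx (w.injective (PM.ext_idx h hs))
      rwa [PM.idx_pos, PM.idx_pos] at h1
    -- Equal indices with opposite signs would make a positive letter equal to a negative one, as
    -- `w` is injective and odd.
    · have h1 : w (PM.pos i) = w (PM.pos j).neg := by
        rw [hw]
        refine PM.ext_idx (by rw [PM.idx_neg]; exact h) ?_
        rw [PM.zero_lt_neg]
        tauto
      have h2 := PM.zero_lt_pos i
      rw [w.injective h1, PM.zero_lt_neg] at h2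
      exact absurd (PM.zero_lt_pos j) h2
  let σ : Equiv.Perm (Fin n) := Equiv.ofBijective _ (Finite.injective_iff_bijective.mp hf)
  have hσ : ∀ j, σ j = (w (PM.pos j)).idx := fun _ => rfl
  refine ⟨Finset.univ.filter fun k => ¬ 0 < (w (PM.pos (σ.symm k))).1, σ, ?_⟩
  have hpos : ∀ j, signedMap (Finset.univ.filter fun k => ¬ 0 < (w (PM.pos (σ.symm k))).1) σ
      (PM.pos j) = w (PM.pos j) := by
    intro j
    refine PM.ext_idx ?_ ?_
    · rw [idx_signedMap, PM.idx_pos, hσ]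
    · rw [zero_lt_signedMap, PM.idx_pos, Finset.mem_filter, Equiv.symm_apply_apply]
      have := PM.zero_lt_pos j
      have := Finset.mem_univ (σ j)
      tauto
  ext1 z
  rw [signedPerm_apply]
  by_cases hz : 0 < z.1
  · rw [PM.eq_pos hz, hpos]
  · rw [← PM.zero_lt_neg] at hz
    rw [← PM.neg_neg z, PM.eq_pos hz, signedMap_neg, hpos, hw]

/-- For fixed `N` the type B derangements are the `σ` whose fixed points all carry a negative sign;
the polynomial of each fixed-point set `T` depends only on `T.card`, whatever the signed order. -/
lemma derangementPolyB_eq_sum (n : ℕ) :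
    derangementPolyB n = ∑ N : Finset (Fin n), ∑ T ∈ N.powerset, derangementPoly (n - T.card) := by
  classical
  have h1 : ∀ N : Finset (Fin n), ∑ T ∈ N.powerset, derangementPoly (n - T.card) =
      ∑ σ : Equiv.Perm (Fin n) with ∀ i, σ i = i → i ∈ N,
        (X : ℚ[X]) ^ excOn (fun j => (signedLetter N j).1) σ := by
    intro N
    have h := sum_fixedPoints_subset_excOn _ (signedLetter_val_injective N) N
    rw [Fintype.card_fin] at h
    convert h.symm
  simp only [h1]
  simp only [Finset.sum_filter]
  rw [← Fintype.sum_prod_type' (f := fun (N : Finset (Fin n)) (σ : Equiv.Perm (Fin n)) =>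
    if ∀ i, σ i = i → i ∈ N then (X : ℚ[X]) ^ excOn (fun j => (signedLetter N j).1) σ else 0),
    ← Finset.sum_filter, derangementPolyB]
  symm
  refine Finset.sum_nbij (fun p => signedPerm p.1 p.2) ?_ signedPerm_injective.injOn ?_ ?_
  · rintro ⟨N, σ⟩ h
    rw [Finset.mem_filter] at h ⊢
    exact ⟨Finset.mem_univ _, (isDerangementB_signedPerm N σ).mpr h.2⟩
  · intro w hw
    have hw := (Finset.mem_filter.mp (Finset.mem_coe.mp hw)).2
    obtain ⟨N, σ, rfl⟩ := exists_signedPerm_eq hw.1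
    exact ⟨(N, σ), Finset.mem_coe.mpr (Finset.mem_filter.mpr
      ⟨Finset.mem_univ _, (isDerangementB_signedPerm N σ).mp hw⟩), rfl⟩
  · rintro ⟨N, σ⟩ _
    rw [excB_signedPerm]

/-- Exchange the sums: a set `T` of size `k` lies in `2 ^ (n - k)` sets `N`. The factor `1` is the
coefficient sequence of the exponential in `egf_mul`. -/
lemma derangementPolyB_eq_sum_derangementPoly (n : ℕ) :
    derangementPolyB n = ∑ k ∈ Finset.range (n + 1),
      (n.choose k : ℚ[X]) * 1 * (C (2 ^ (n - k)) * derangementPoly (n - k)) := by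
  rw [derangementPolyB_eq_sum, Finset.sum_comm' (s' := fun T => Finset.Icc T Finset.univ)
    (t' := Finset.univ) fun N T => by simp]
  have h2 := Finset.sum_powerset_apply_card
    (fun k => C ((2 : ℚ) ^ (n - k)) * derangementPoly (n - k)) (x := (Finset.univ : Finset (Fin n)))
  rw [Finset.card_univ, Fintype.card_fin, Finset.powerset_univ] at h2
  simp only [mul_one, ← nsmul_eq_mul]
  rw [← h2]
  refine Finset.sum_congr rfl fun T _ => ?_
  rw [Finset.sum_const, Finset.card_Icc_finset (Finset.subset_univ T), Finset.card_univ,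
    Fintype.card_fin, nsmul_eq_mul, C_pow, map_ofNat, Nat.cast_pow, Nat.cast_ofNat]

lemma egf_derangementPolyB :
    egf derangementPolyB =
      PowerSeries.exp ℚ[X] * PowerSeries.rescale (C 2) (egf derangementPoly) := by
  rw [← egf_one, rescale_egf, egf_mul]
  exact congrArg egf (funext derangementPolyB_eq_sum_derangementPoly)

/-- Halving `t` undoes the doubling in `d(2t)`, makes the two exponentials multiply to `exp(t)`, and
produces the factor `1 / 2 ^ n` on coefficients. -/
lemma rescale_egf_derangementPolyB_sq :
    PowerSeries.rescale (C (1 / 2)) (egf derangementPolyB * egf derangementPolyB) = egf S := by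
  have h1 : PowerSeries.rescale (C (1 / 2)) (PowerSeries.rescale (C 2) (egf derangementPoly)) =
      egf derangementPoly := by
    rw [PowerSeries.rescale_rescale, ← C_mul]
    norm_num
  have h2 : PowerSeries.rescale (C (1 / 2)) (PowerSeries.exp ℚ[X]) *
      PowerSeries.rescale (C (1 / 2)) (PowerSeries.exp ℚ[X]) = PowerSeries.exp ℚ[X] := by
    rw [PowerSeries.exp_mul_exp_eq_exp_add, ← C_add]
    norm_num
  rw [egf_derangementPolyB, map_mul, map_mul, h1, egf_S, egf_eulerian]
  linear_combination (egf derangementPoly) ^ 2 * h2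

end SuccessionFree

theorem mainTheorem4 (n : ℕ) :
    SuccessionFree.S n =
        Polynomial.C ((1 : ℚ) / 2 ^ n) *
          ∑ i ∈ Finset.range (n + 1), (n.choose i : Polynomial ℚ) *
            SuccessionFree.derangementPolyB i * SuccessionFree.derangementPolyB (n - i) ∧
      SuccessionFree.S n =
        ∑ i ∈ Finset.range (n + 1), (n.choose i : Polynomial ℚ) *
          SuccessionFree.eulerian i * SuccessionFree.derangementPoly (n - i) := by
  constructor
  · have h := SuccessionFree.rescale_egf_derangementPolyB_sq
    rw [SuccessionFree.egf_mul, SuccessionFree.rescale_egf] at h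
    rw [← congrFun (SuccessionFree.egf_injective h) n, one_div_pow]
  · have h := SuccessionFree.egf_S
    rw [SuccessionFree.egf_mul] at h
    exact congrFun (SuccessionFree.egf_injective h) n
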